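/- Setting. Let $n\ge 1$, let $x_0\in\mathbb{R}^d$ and let $x_1,\dots,x_n\in\mathbb{R}^d$ be distinct points, ordered so that $\|x_i-x_0\|$ is nondecreasing in $i$, with $x_1\neq x_0$ and, if $n\ge 2$, $\|x_1-x_0\|<\|x_2-x_0\|$. Let $\sigma_1,\dots,\sigma_n>0$ and $C\ge 0$ be known. The parameter space $\Theta$ is the set of all functions $\theta:\mathbb{R}^d\to\mathbb{R}$ that are Lipschitz with constant $C$. One observes $Y\sim N(m(\theta),\Sigma)$ with $m(\theta)=(\theta(x_1),\dots,\theta(x_n))^\top$ and $\Sigma=\operatorname{diag}(\sigma_1^2,\dots,\sigma_n^2)$. The welfare contrast is $U(\theta)=\theta(x_0)$. For a decision rule (a measurable map $d:\mathbb{R}^n\to[0,1]$), the vector $w^*=(1,0,\dots,0)^\top$ and $\gamma\in\mathbb{R}$, the $w^*$-profiled regret is $$\overline{R}_{w^*}(d,\gamma)=\sup_{\theta\in\Theta:\ (w^*)^\top m(\theta)=\gamma}U(\theta)\left(\mathbf{1}\{U(\theta)\ge 0\}-\mathbb{E}_{m(\theta)}[d(Y)]\right).$$ Let $\Phi$ and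 $\phi$ be the standard normal distribution function and density, and put $k=C\|x_1-x_0\|$. Assume $k>\sqrt{\pi/2}\,\sigma_1$. Let $d^*_{\text{RT}}(Y)=\Phi(Y_1/\tilde\sigma)$ with $\tilde\sigma=\sqrt{2k^2/\pi-\sigma_1^2}$. Let $d^*_{\text{linear}}(Y)$ equal $0$ if $Y_1<-\rho^*$, $\frac{Y_1+\rho^*}{2\rho^*}$ if $-\rho^*\le Y_1\le\rho^*$, and $1$ if $Y_1>\rho^*$, where $\rho^*$ is the unique number in $(0,k)$ with $\rho^*=k\,(1-2\Phi(-\rho^*/\sigma_1))$ (existence and uniqueness of $\rho^*$ are part of the claim). Proposition. (i) If $\phi\left(\frac{\rho^*}{\sigma_1}\right)\left(\frac{k}{\sqrt{\pi/2}\,\sigma_1}\right)^3\le\phi(0)$, then $\overline{R}_{w^*}(d^*_{\text{linear}},\gamma)\le\overline{R}_{w^*}(d^*_{\text{RT}},\gamma)$ for all $\gamma\in\mathbb{R}$, and the inequality is strict for all $\gamma\neq 0$. (ii) If $\phi\left(\frac{\rho^*}{\sigma_1}\right)\left(\frac{k}{\sqrt{\pi/2}\,\sigma_1}\right)^3>\phi(0)$,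 then there is a unique $\underline\gamma\in(0,\infty)$ with $$\Phi\left(-\frac{\underline\gamma}{k/\sqrt{\pi/2}}\right)=\int_0^1\Phi\left(\frac{2\rho^*x-\rho^*-\underline\gamma}{\sigma_1}\right)dx,$$ and $\overline{R}_{w^*}(d^*_{\text{linear}},\gamma)<\overline{R}_{w^*}(d^*_{\text{RT}},\gamma)$ for all $|\gamma|>\underline\gamma$. -/

import Mathlib

noncomputable section

/-- The distribution function `Φ` of the standard normal law. -/
def stdNormalCDF (t : ℝ) : ℝ := ProbabilityTheory.cdf (ProbabilityTheory.gaussianReal 0 1) t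

/-- The density `φ` of the standard normal law. -/
def stdNormalPDF (t : ℝ) : ℝ := ProbabilityTheory.gaussianPDFReal 0 1 t

/-- A decision rule: a measurable map from the data in `ℝⁿ` to the unit interval. -/
structure DecisionRule (n : ℕ) where
  toFun : EuclideanSpace ℝ (Fin n) → ℝ
  measurable_toFun : Measurable toFun
  mem_Icc : ∀ y, toFun y ∈ Set.Icc (0 : ℝ) 1

/-- The rule `y ↦ f (wᵀ y)`, which uses the data only through the linear index `wᵀ y`. -/
def DecisionRule.ofIndex {n : ℕ} (w : EuclideanSpace ℝ (Fin n)) (f : ℝ → ℝ) (hf : Measurable f)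
    (hf01 : ∀ t, f t ∈ Set.Icc (0 : ℝ) 1) : DecisionRule n where
  toFun y := f (inner ℝ w y)
  measurable_toFun := hf.comp (by fun_prop)
  mem_Icc y := hf01 _

/-- The piecewise linear function of `t` that is `0` below `-ρ`, `1` above `ρ`, and
`(t + ρ) / (2 ρ)` in between. -/
def piecewiseLinear (ρ t : ℝ) : ℝ :=
  if t < -ρ then 0 else if t ≤ ρ then (t + ρ) / (2 * ρ) else 1

theorem measurable_piecewiseLinear (ρ : ℝ) : Measurable (piecewiseLinear ρ) := by
  unfold piecewiseLinear
  refine Measurable.ite measurableSet_Iio measurable_const ?_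
  exact Measurable.ite measurableSet_Iic (by fun_prop) measurable_const

theorem piecewiseLinear_mem_Icc (ρ t : ℝ) : piecewiseLinear ρ t ∈ Set.Icc (0 : ℝ) 1 := by
  unfold piecewiseLinear
  split_ifs with h1 h2
  · simp
  · have hρ : 0 ≤ ρ := by linarith
    exact ⟨div_nonneg (by linarith) (by linarith),
      div_le_one_of_le₀ (by linarith) (by linarith)⟩
  · simp

theorem measurable_stdNormalCDF : Measurable stdNormalCDF :=
  (ProbabilityTheory.monotone_cdf _).measurable

theorem stdNormalCDF_mem_Icc (t : ℝ) : stdNormalCDF t ∈ Set.Icc (0 : ℝ) 1 :=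
  ⟨ProbabilityTheory.cdf_nonneg _ t, ProbabilityTheory.cdf_le_one _ t⟩

/-- The evidence aggregation problem. Country `0` of the text is the target, with covariates `x₀`;
countries `1, …, n` are indexed by `Fin n`, so that the index `0 : Fin n` is the nearest neighbor
of the target. -/
structure EvidenceAggregation (d n : ℕ) [NeZero n] where
  /-- covariates of the target country -/
  x₀ : EuclideanSpace ℝ (Fin d)
  /-- covariates of the countries with experimental estimates -/
  x : Fin n → EuclideanSpace ℝ (Fin d)
  /-- standard deviations of the estimates -/
  σ : Fin n → ℝ
  /-- the known Lipschitz constant -/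
  C : NNReal
  σ_pos : ∀ i, 0 < σ i
  x_injective : Function.Injective x
  x_ordered : Monotone fun i => ‖x i - x₀‖
  x_nearest_ne : x 0 ≠ x₀
  x_nearest_unique : ∀ i, 0 < i → ‖x 0 - x₀‖ < ‖x i - x₀‖

namespace EvidenceAggregation

variable {d n : ℕ} [NeZero n] (E : EvidenceAggregation d n)

/-- The parameter space: all `C`-Lipschitz functions `ℝᵈ → ℝ`. -/
def Θ : Set (EuclideanSpace ℝ (Fin d) → ℝ) := {θ | LipschitzWith E.C θ}

/-- The mean function `m(θ) = (θ(x₁), …, θ(xₙ))`. -/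
def m (θ : EuclideanSpace ℝ (Fin d) → ℝ) : EuclideanSpace ℝ (Fin n) :=
  WithLp.toLp 2 fun i => θ (E.x i)

/-- The covariance matrix `Σ = diag(σ₁², …, σₙ²)`. -/
def cov : Matrix (Fin n) (Fin n) ℝ := Matrix.diagonal fun i => E.σ i ^ 2

/-- The welfare contrast `U(θ) = θ(x₀)`. -/
def U (θ : EuclideanSpace ℝ (Fin d) → ℝ) : ℝ := θ E.x₀

/-- `𝔼[δ(Y)]` for `Y ∼ N(m(θ), Σ)`. -/
def expectedAction (δ : DecisionRule n) (θ : EuclideanSpace ℝ (Fin d) → ℝ) : ℝ :=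
  ∫ y, δ.toFun y ∂(ProbabilityTheory.multivariateGaussian (E.m θ) E.cov)

open Classical in
/-- The expected regret `U(θ) (𝟏{U(θ) ≥ 0} - 𝔼[δ(Y)])`. -/
def regret (δ : DecisionRule n) (θ : EuclideanSpace ℝ (Fin d) → ℝ) : ℝ :=
  E.U θ * ((if 0 ≤ E.U θ then 1 else 0) - E.expectedAction δ θ)

/-- The values of expected regret over all `θ ∈ Θ` with `wᵀ m(θ) = γ`. -/
def regretValues (w : EuclideanSpace ℝ (Fin n)) (δ : DecisionRule n) (γ : ℝ) : Set ℝ :=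
  {r | ∃ θ ∈ E.Θ, inner ℝ w (E.m θ) = γ ∧ E.regret δ θ = r}

/-- The `w`-profiled regret: the supremum of expected regret over all `θ ∈ Θ` with
`wᵀ m(θ) = γ`. -/
def profiledRegret (w : EuclideanSpace ℝ (Fin n)) (δ : DecisionRule n) (γ : ℝ) : ℝ :=
  sSup (E.regretValues w δ γ)

/-- The nearest-neighbor weights `w* = (1, 0, …, 0)`. -/
def wStar (n : ℕ) [NeZero n] : EuclideanSpace ℝ (Fin n) := EuclideanSpace.single 0 1

/-- `k = C ‖x₁ - x₀‖`. -/
def k : ℝ := E.C * ‖E.x 0 - E.x₀‖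

/-- The standard deviation `σ₁` of the estimate for the nearest neighbor. -/
def σ₁ : ℝ := E.σ 0

/-- The constant `√(2 C² ‖x₁ - x₀‖² / π - σ₁²)`. -/
def σTilde : ℝ := Real.sqrt (2 * E.k ^ 2 / Real.pi - E.σ₁ ^ 2)

/-- The rule `Φ(w*ᵀ Y / σ̃)`. -/
def dRT : DecisionRule n :=
  DecisionRule.ofIndex (wStar n) (fun t => stdNormalCDF (t / E.σTilde))
    (measurable_stdNormalCDF.comp (by fun_prop)) (fun _ => stdNormalCDF_mem_Icc _)

/-- The piecewise linear rule with cutoffs `±ρ` in the index `w*ᵀ Y`. -/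
def dLinear (n : ℕ) [NeZero n] (ρ : ℝ) : DecisionRule n :=
  DecisionRule.ofIndex (wStar n) (piecewiseLinear ρ) (measurable_piecewiseLinear ρ)
    (piecewiseLinear_mem_Icc ρ)

/-- The property that characterizes the cutoff `ρ*`: it lies in `(0, k)` and solves
`ρ = k (1 - 2 Φ(-ρ / σ₁))`. -/
def IsRhoStar (ρ : ℝ) : Prop :=
  0 < ρ ∧ ρ < E.k ∧ ρ = E.k * (1 - 2 * stdNormalCDF (-ρ / E.σ₁))

/-- The property that characterizes the threshold `γ̲`, given the cutoff `ρ`. -/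
def IsThreshold (ρ γ : ℝ) : Prop :=
  0 < γ ∧ stdNormalCDF (-(γ / (E.k / Real.sqrt (Real.pi / 2)))) =
    ∫ t in (0 : ℝ)..1, stdNormalCDF ((2 * ρ * t - ρ - γ) / E.σ₁)

theorem inner_wStar (y : EuclideanSpace ℝ (Fin n)) : inner ℝ (wStar n) y = y 0 := by
  simp [wStar, EuclideanSpace.inner_single_left]

/-- The supremum in the definition of the `w*`-profiled regret is over a non-empty bounded set, for
every rule and every real `γ`. -/
theorem isLUB_profiledRegret (δ : DecisionRule n) (γ : ℝ) :
    IsLUB (E.regretValues (wStar n) δ γ) (E.profiledRegret (wStar n) δ γ) := by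
  refine isLUB_csSup ⟨_, fun _ => γ, ?_, ?_, rfl⟩ ⟨|γ| + E.k, ?_⟩
  · exact LipschitzWith.const' γ
  · simp [inner_wStar, m]
  · rintro r ⟨θ, hθ, hγ, rfl⟩
    have hθ' : LipschitzWith E.C θ := hθ
    have h1 := hθ'.dist_le_mul E.x₀ (E.x 0)
    have hγ' : θ (E.x 0) = γ := by simpa [inner_wStar, m] using hγ
    rw [dist_comm E.x₀, dist_eq_norm (E.x 0), hγ', Real.dist_eq] at h1
    have hU : |E.U θ| ≤ |γ| + E.k := by
      have h2 : |θ E.x₀| - |γ| ≤ |θ E.x₀ - γ| := abs_sub_abs_le_abs_sub _ _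
      unfold U k
      linarith
    have hint : E.expectedAction δ θ ∈ Set.Icc (0 : ℝ) 1 := by
      refine ⟨MeasureTheory.integral_nonneg fun y => (δ.mem_Icc y).1, ?_⟩
      have h3 := MeasureTheory.norm_integral_le_of_norm_le_const
        (μ := ProbabilityTheory.multivariateGaussian (E.m θ) E.cov) (f := δ.toFun) (C := 1)
        (Filter.Eventually.of_forall fun y => by
          rw [Real.norm_eq_abs, abs_of_nonneg (δ.mem_Icc y).1]; exact (δ.mem_Icc y).2)
      simp only [MeasureTheory.measureReal_def, MeasureTheory.measure_univ, ENNReal.toReal_one,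
        mul_one] at h3
      exact (le_abs_self _).trans h3
    refine le_trans ?_ hU
    unfold regret
    split_ifs with h
    · rw [abs_of_nonneg h]
      nlinarith [hint.1]
    · rw [abs_of_neg (not_le.mp h)]
      nlinarith [hint.2, not_le.mp h]

end EvidenceAggregation

end

noncomputable section

open MeasureTheory ProbabilityTheory Set Filter Topology

/-! Both rules see only `Y₁ ∼ N(γ, σ₁²)`, so once `θ(x₁) = γ` is fixed the expected action is a
constant `p`, while `U(θ)` lies in `[γ - k, γ + k]` with both ends attained. The profiled regret is
therefore `max ((γ + k)(1 - p)) ((k - γ) p)` (`profiledRegret_wStar_eq`). By symmetry take `γ > 0`.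

In units of `σ₁` put `r = ρ*/σ₁`, `g = γ/σ₁`, `s = k/(√(π/2) σ₁)`. Then `1 - p` is `Φ(-g/s)` for the
RT rule and `averageCDF r g` for the linear rule: the upper tails at `g` of `N(0, s²)` and of a
uniform law on `[-r, r]` convolved with `N(0, 1)`. The equation for `ρ*` says that these two laws
have the same density at `0`.

Two facts finish the proof. The linear rule's tail lies above its tangent at `0` (`le_averageCDF`),
so the first branch is its maximum. And its tail is strictly below the normal one (`averageCDF_lt`):
the ratio of its density to the normal density can only rise and then fall, and both tails are `1/2`
at `0` and vanish at infinity.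

The case split is illusory: by Jensen the condition of (i) always holds
(`stdNormalPDF_mul_pow_three_le`), so (ii) is vacuous. -/

/-! ### Calculus of the standard normal law. -/

theorem stdNormalPDF_eq (t : ℝ) :
    stdNormalPDF t = (√(2 * Real.pi))⁻¹ * Real.exp (-t ^ 2 / 2) := by
  simp [stdNormalPDF, gaussianPDFReal]

theorem stdNormalPDF_pos (t : ℝ) : 0 < stdNormalPDF t :=
  gaussianPDFReal_pos _ _ _ one_ne_zero

theorem hasDerivAt_stdNormalPDF (t : ℝ) :
    HasDerivAt stdNormalPDF (-(t * stdNormalPDF t)) t := by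
  have h : HasDerivAt (fun t : ℝ => -t ^ 2 / 2) (-t) t := by
    have := ((hasDerivAt_pow 2 t).neg).div_const 2
    convert! this using 1
    simp; ring
  have h2 := (h.exp).const_mul (√(2 * Real.pi))⁻¹
  rw [show stdNormalPDF = fun t => (√(2 * Real.pi))⁻¹ * Real.exp (-t ^ 2 / 2) from
    funext stdNormalPDF_eq]
  convert! h2 using 1
  ring

@[fun_prop]
theorem continuous_stdNormalPDF : Continuous stdNormalPDF :=
  continuous_iff_continuousAt.2 fun t => (hasDerivAt_stdNormalPDF t).continuousAt

theorem stdNormalCDF_eq_integral (t : ℝ) : stdNormalCDF t = ∫ x in Iic t, stdNormalPDF x := by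
  rw [stdNormalCDF, cdf_eq_real, measureReal_def, gaussianReal_apply_eq_integral _ one_ne_zero,
    ENNReal.toReal_ofReal]
  · rfl
  · exact integral_nonneg fun x => gaussianPDFReal_nonneg _ _ _

theorem stdNormalCDF_sub (a b : ℝ) :
    stdNormalCDF b - stdNormalCDF a = ∫ x in a..b, stdNormalPDF x := by
  rw [stdNormalCDF_eq_integral, stdNormalCDF_eq_integral]
  exact intervalIntegral.integral_Iic_sub_Iic (integrable_gaussianPDFReal _ _).integrableOn
    (integrable_gaussianPDFReal _ _).integrableOn

theorem hasDerivAt_stdNormalCDF (t : ℝ) : HasDerivAt stdNormalCDF (stdNormalPDF t) t := by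
  have h := (continuous_stdNormalPDF.integral_hasStrictDerivAt 0 t).hasDerivAt
  have h2 : stdNormalCDF = fun t => (∫ x in (0 : ℝ)..t, stdNormalPDF x) + stdNormalCDF 0 := by
    funext t
    rw [← stdNormalCDF_sub]; ring
  rw [h2]
  exact h.add_const _

@[fun_prop]
theorem continuous_stdNormalCDF : Continuous stdNormalCDF :=
  continuous_iff_continuousAt.2 fun t => (hasDerivAt_stdNormalCDF t).continuousAt

theorem monotone_stdNormalCDF : Monotone stdNormalCDF := monotone_cdf _

theorem strictMono_stdNormalCDF : StrictMono stdNormalCDF :=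
  strictMono_of_deriv_pos fun t => by
    rw [(hasDerivAt_stdNormalCDF t).deriv]; exact stdNormalPDF_pos t

theorem tendsto_stdNormalCDF_atBot : Tendsto stdNormalCDF atBot (𝓝 0) := tendsto_cdf_atBot _

/-! ### Gaussian tails and the means of the two rules. -/

theorem gaussianReal_real_Ici (γ c : ℝ) {σ : ℝ} (hσ : 0 < σ) :
    (gaussianReal γ (σ ^ 2).toNNReal).real (Ici c) = stdNormalCDF ((γ - c) / σ) := by
  -- The reflected scaling `-σ` turns the upper tail into a lower one, matching the definition of
  -- `Φ`.
  have h : gaussianReal γ (σ ^ 2).toNNReal = (gaussianReal 0 1).map (fun z => γ + -σ * z) := by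
    rw [show (fun z => γ + -σ * z) = (fun z => γ + z) ∘ (fun z => -σ * z) from rfl,
      ← Measure.map_map (by fun_prop) (by fun_prop), gaussianReal_map_const_mul,
      gaussianReal_map_const_add]
    congr 1
    · ring
    · ext; simp [sq_nonneg]
  rw [h, map_measureReal_apply (by fun_prop) measurableSet_Ici, stdNormalCDF, cdf_eq_real]
  congr 1
  ext z
  simp only [mem_preimage, mem_Ici, mem_Iic, le_div_iff₀ hσ]
  constructor <;> intro h <;> linarith

theorem stdNormalCDF_neg (t : ℝ) : stdNormalCDF (-t) = 1 - stdNormalCDF t := by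
  have h := gaussianReal_real_Ici 0 t one_pos
  have : NullSingletonClass (gaussianReal 0 1) := nullSingletonClass_gaussianReal one_ne_zero
  simp only [one_pow, Real.toNNReal_one, zero_sub, div_one] at h
  rw [← h, stdNormalCDF, cdf_eq_real, ← probReal_compl_eq_one_sub measurableSet_Iic, compl_Iic]
  exact measureReal_congr Ioi_ae_eq_Ici.symm

/-- The mean of `Φ(Y / τ)` for a normal `Y`. -/
theorem integral_stdNormalCDF_div (γ : ℝ) {σ τ : ℝ} (hσ : 0 < σ) (hτ : 0 < τ) :
    ∫ t, stdNormalCDF (t / τ) ∂gaussianReal γ (σ ^ 2).toNNReal =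
      stdNormalCDF (γ / √(σ ^ 2 + τ ^ 2)) := by
  have hs : 0 < √(σ ^ 2 + τ ^ 2) := by positivity
  -- `Φ(x/τ)` is the probability that `x + W ≥ 0` for `W ∼ N(0, τ²)`, so the mean is `ℙ(Y + W ≥ 0)`
  -- with `Y + W ∼ N(γ, σ² + τ²)`.
  have h1 := gaussianReal_real_Ici γ 0 hs
  rw [Real.sq_sqrt (by positivity), Real.toNNReal_add (by positivity) (by positivity),
    ← add_zero γ, ← gaussianReal_conv_gaussianReal, add_zero, sub_zero] at h1
  rw [← h1, ← integral_indicator_one measurableSet_Ici, integral_conv]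
  · refine integral_congr_ae (ae_of_all _ fun x => ?_)
    have h2 := gaussianReal_real_Ici 0 (-x) hτ
    rw [zero_sub, neg_neg] at h2
    change stdNormalCDF (x / τ) = _
    rw [← h2, ← integral_indicator_one measurableSet_Ici]
    refine integral_congr_ae (ae_of_all _ fun y => ?_)
    simp only [indicator, mem_Ici, neg_le_iff_add_nonneg, add_comm, Pi.one_apply]
  · exact (integrable_const (1 : ℝ)).indicator measurableSet_Ici

/-- The rule is a threshold rule with cutoff uniform on `[-ρ, ρ]`; Fubini then reduces its mean to
an average of normal tails. -/
theorem piecewiseLinear_eq_integral {ρ : ℝ} (hρ : 0 < ρ) (t : ℝ) :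
    piecewiseLinear ρ t =
      ∫ x in Icc (0 : ℝ) 1, (Ici (2 * ρ * x - ρ)).indicator (1 : ℝ → ℝ) t := by
  have h : ∀ x : ℝ, (Ici (2 * ρ * x - ρ)).indicator (1 : ℝ → ℝ) t =
      (Iic ((t + ρ) / (2 * ρ))).indicator 1 x := by
    intro x
    have : 2 * ρ * x - ρ ≤ t ↔ x ≤ (t + ρ) / (2 * ρ) := by
      rw [le_div_iff₀ (by positivity)]
      constructor <;> intro h <;> linarith
    simp [indicator, this]
  simp_rw [h]
  rw [integral_indicator_one measurableSet_Iic, measureReal_restrict_apply measurableSet_Iic,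
    piecewiseLinear]
  split_ifs with h1 h2
  · have : (t + ρ) / (2 * ρ) < 0 := div_neg_of_neg_of_pos (by linarith) (by positivity)
    rw [show Iic ((t + ρ) / (2 * ρ)) ∩ Icc (0 : ℝ) 1 = ∅ by
      ext x; simp only [mem_inter_iff, mem_Iic, mem_Icc, mem_empty_iff_false, iff_false]
      intro h; linarith [h.2.1, h.1]]
    simp
  · have h0 : 0 ≤ (t + ρ) / (2 * ρ) := div_nonneg (by linarith) (by positivity)
    have h3 : (t + ρ) / (2 * ρ) ≤ 1 := div_le_one_of_le₀ (by linarith) (by positivity)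
    rw [show Iic ((t + ρ) / (2 * ρ)) ∩ Icc (0 : ℝ) 1 = Icc 0 ((t + ρ) / (2 * ρ)) by
      ext x; simp only [mem_inter_iff, mem_Iic, mem_Icc]
      exact ⟨fun h => ⟨h.2.1, h.1⟩, fun h => ⟨h.2, h.1, h.2.trans h3⟩⟩]
    simp [h0]
  · have : 1 ≤ (t + ρ) / (2 * ρ) := by
      rw [le_div_iff₀ (by positivity)]; linarith
    rw [show Iic ((t + ρ) / (2 * ρ)) ∩ Icc (0 : ℝ) 1 = Icc 0 1 by
      ext x; simp only [mem_inter_iff, mem_Iic, mem_Icc]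
      exact ⟨fun h => h.2, fun h => ⟨h.2.trans this, h⟩⟩]
    simp

/-- The mean of the piecewise linear rule for a normal `Y`. -/
theorem integral_piecewiseLinear (γ : ℝ) {σ ρ : ℝ} (hσ : 0 < σ) (hρ : 0 < ρ) :
    ∫ t, piecewiseLinear ρ t ∂gaussianReal γ (σ ^ 2).toNNReal =
      1 - ∫ x in (0 : ℝ)..1, stdNormalCDF ((2 * ρ * x - ρ - γ) / σ) := by
  simp_rw [piecewiseLinear_eq_integral hρ]
  rw [integral_integral_swap]
  · simp_rw [integral_indicator_one measurableSet_Ici, gaussianReal_real_Ici γ _ hσ]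
    rw [integral_Icc_eq_integral_Ioc, ← intervalIntegral.integral_of_le zero_le_one]
    have h : ∀ x : ℝ, stdNormalCDF ((γ - (2 * ρ * x - ρ)) / σ) =
        1 - stdNormalCDF ((2 * ρ * x - ρ - γ) / σ) := by
      intro x
      rw [← stdNormalCDF_neg]
      congr 1; ring
    simp_rw [h]
    rw [intervalIntegral.integral_sub (by simp) (Continuous.intervalIntegrable (by fun_prop) _ _)]
    simp
  · refine Integrable.of_bound (C := 1) ?_ (ae_of_all _ ?_)
    · have : (Function.uncurry fun (t x : ℝ) => (Ici (2 * ρ * x - ρ)).indicator (1 : ℝ → ℝ) t) =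
          {p : ℝ × ℝ | 2 * ρ * p.2 - ρ ≤ p.1}.indicator 1 := by
        ext ⟨t, x⟩; simp [indicator]
      rw [this]
      refine (measurable_one.indicator ?_).aestronglyMeasurable
      exact measurableSet_le (by fun_prop) (by fun_prop)
    · rintro ⟨t, x⟩
      simp only [Function.uncurry, indicator]
      split_ifs <;> simp

theorem stdNormalPDF_neg (t : ℝ) : stdNormalPDF (-t) = stdNormalPDF t := by
  simp [stdNormalPDF_eq]

theorem stdNormalCDF_zero : stdNormalCDF 0 = 1 / 2 := by
  have h := stdNormalCDF_neg 0
  rw [neg_zero] at h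
  linarith

/-! ### Strict total positivity of the folded normal kernel. -/

/-- The ratio `sinh (b t) / sinh (a t)` increases in `t`: the numerator `W` of its derivative
vanishes at `0` and has a positive derivative. -/
theorem Real.sinh_mul_mul_sinh_mul_lt {a b x y : ℝ} (ha : 0 < a) (hab : a < b) (hx : 0 < x)
    (hxy : x < y) :
    Real.sinh (b * x) * Real.sinh (a * y) < Real.sinh (a * x) * Real.sinh (b * y) := by
  have hb : 0 < b := ha.trans hab
  have hs : ∀ c t : ℝ, HasDerivAt (fun t => Real.sinh (c * t)) (Real.cosh (c * t) * c) t := by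
    intro c t
    simpa using ((hasDerivAt_id t).const_mul c).sinh
  have hc : ∀ c t : ℝ, HasDerivAt (fun t => Real.cosh (c * t)) (Real.sinh (c * t) * c) t := by
    intro c t
    simpa using ((hasDerivAt_id t).const_mul c).cosh
  have hspos : ∀ c t : ℝ, 0 < c → 0 < t → 0 < Real.sinh (c * t) := fun c t h1 h2 =>
    Real.sinh_pos_iff.2 (mul_pos h1 h2)
  set W : ℝ → ℝ := fun t => b * Real.cosh (b * t) * Real.sinh (a * t) -
    a * Real.sinh (b * t) * Real.cosh (a * t) with hW
  have hWd : ∀ t, HasDerivAt W ((b ^ 2 - a ^ 2) * (Real.sinh (b * t) * Real.sinh (a * t))) t := by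
    intro t
    convert! (((hc b t).const_mul b).mul (hs a t)).sub (((hs b t).const_mul a).mul (hc a t)) using 1
    ring
  have hWmono : StrictMonoOn W (Ici 0) := by
    refine strictMonoOn_of_hasDerivWithinAt_pos (convex_Ici 0)
      (fun t _ => (hWd t).continuousAt.continuousWithinAt)
      (fun t _ => (hWd t).hasDerivWithinAt) ?_
    intro t ht
    rw [interior_Ici, mem_Ioi] at ht
    have := hspos b t hb ht
    have := hspos a t ha ht
    have : 0 < b ^ 2 - a ^ 2 := by nlinarith
    positivity
  have hWpos : ∀ t, 0 < t → 0 < W t := by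
    intro t ht
    have := hWmono self_mem_Ici ht.le ht
    simpa [hW] using this
  have hR : StrictMonoOn (fun t => Real.sinh (b * t) / Real.sinh (a * t)) (Ioi 0) := by
    have hd : ∀ t ∈ Ioi (0 : ℝ), HasDerivAt (fun t => Real.sinh (b * t) / Real.sinh (a * t))
        (W t / Real.sinh (a * t) ^ 2) t := by
      intro t ht
      convert! (hs b t).div (hs a t) (hspos a t ha ht).ne' using 1
      simp only [hW]; ring
    refine strictMonoOn_of_hasDerivWithinAt_pos (convex_Ioi 0)
      (fun t ht => (hd t ht).continuousAt.continuousWithinAt)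
      (fun t ht => (hd t (interior_subset ht)).hasDerivWithinAt) ?_
    intro t ht
    have ht : 0 < t := interior_subset ht
    have := hspos a t ha ht
    have := hWpos t ht
    positivity
  have h := hR hx (hx.trans hxy) hxy
  simp only at h
  rw [div_lt_div_iff₀ (hspos a x ha hx) (hspos a y ha (hx.trans hxy))] at h
  linarith

theorem stdNormalPDF_sub_sub_add (x g : ℝ) :
    stdNormalPDF (x - g) - stdNormalPDF (x + g) =
      2 * (√(2 * Real.pi))⁻¹ * Real.exp (-g ^ 2 / 2) * (Real.exp (-x ^ 2 / 2) *
        Real.sinh (g * x)) := by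
  rw [stdNormalPDF_eq, stdNormalPDF_eq, Real.sinh_eq,
    show -(x - g) ^ 2 / 2 = -g ^ 2 / 2 + -x ^ 2 / 2 + g * x by ring,
    show -(x + g) ^ 2 / 2 = -g ^ 2 / 2 + -x ^ 2 / 2 + -(g * x) by ring,
    Real.exp_add _ (g * x), Real.exp_add _ (-(g * x)), Real.exp_add]
  ring

theorem stdNormalPDF_sub_sub_add_pos {x g : ℝ} (hx : 0 < x) (hg : 0 < g) :
    0 < stdNormalPDF (x - g) - stdNormalPDF (x + g) := by
  rw [stdNormalPDF_sub_sub_add]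
  have := Real.sinh_pos_iff.2 (mul_pos hg hx)
  positivity

/-- Each difference is a function of the point times a function of the shift times a `sinh` of their
product, so only the `sinh` inequality matters. -/
theorem stdNormalPDF_sub_sub_add_mul_lt {a b x y : ℝ} (ha : 0 < a) (hab : a < b) (hx : 0 < x)
    (hxy : x < y) :
    (stdNormalPDF (x - b) - stdNormalPDF (x + b)) * (stdNormalPDF (y - a) - stdNormalPDF (y + a)) <
      (stdNormalPDF (x - a) - stdNormalPDF (x + a)) *
        (stdNormalPDF (y - b) - stdNormalPDF (y + b)) := by
  simp only [stdNormalPDF_sub_sub_add]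
  have h := Real.sinh_mul_mul_sinh_mul_lt ha hab hx hxy
  have hc : 0 < (2 * (√(2 * Real.pi))⁻¹) ^ 2 * Real.exp (-a ^ 2 / 2) * Real.exp (-b ^ 2 / 2) *
      Real.exp (-x ^ 2 / 2) * Real.exp (-y ^ 2 / 2) := by positivity
  linarith [mul_lt_mul_of_pos_left h hc]

/-! ### The density of a smoothed uniform law. -/

/-- The probability that a normal variable with mean `g` and unit variance lies in `[-r, r]`. -/
def normalBandProb (r g : ℝ) : ℝ := stdNormalCDF (r - g) - stdNormalCDF (-r - g)

theorem hasDerivAt_normalBandProb (r g : ℝ) :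
    HasDerivAt (normalBandProb r) (-(stdNormalPDF (r - g) - stdNormalPDF (r + g))) g := by
  have h1 := (hasDerivAt_stdNormalCDF (r - g)).comp g ((hasDerivAt_id g).const_sub r)
  have h2 := (hasDerivAt_stdNormalCDF (-r - g)).comp g ((hasDerivAt_id g).const_sub (-r))
  convert! h1.sub h2 using 1
  rw [show -r - g = -(r + g) by ring, stdNormalPDF_neg]
  ring

/-- Both sides vanish at `r = 0` and have the same derivative in `r`, with `g` fixed. -/
theorem mul_normalBandProb_sub_eq_integral (r g : ℝ) :
    g * normalBandProb r g - (stdNormalPDF (r - g) - stdNormalPDF (r + g)) =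
      ∫ x in (0 : ℝ)..r, x * (stdNormalPDF (x - g) - stdNormalPDF (x + g)) := by
  have hd : ∀ x : ℝ, HasDerivAt
      (fun x => g * normalBandProb x g - (stdNormalPDF (x - g) - stdNormalPDF (x + g)))
      (x * (stdNormalPDF (x - g) - stdNormalPDF (x + g))) x := by
    intro x
    have h1 := (hasDerivAt_stdNormalCDF (x - g)).comp x ((hasDerivAt_id x).sub_const g)
    have h2 := (hasDerivAt_stdNormalCDF (-x - g)).comp x ((hasDerivAt_id x).neg.sub_const g)
    have h3 := (hasDerivAt_stdNormalPDF (x - g)).comp x ((hasDerivAt_id x).sub_const g)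
    have h4 := (hasDerivAt_stdNormalPDF (x + g)).comp x ((hasDerivAt_id x).add_const g)
    convert! ((h1.sub h2).const_mul g).sub (h3.sub h4) using 1
    rw [show -x - g = -(x + g) by ring, stdNormalPDF_neg]
    ring
  rw [intervalIntegral.integral_eq_sub_of_hasDerivAt (fun x _ => hd x)
    (Continuous.intervalIntegrable (by fun_prop) _ _)]
  simp [normalBandProb, stdNormalPDF_neg]

/-- Write `B x g = φ(x - g) - φ(x + g)`. Then `g * normalBandProb r g / B r g = 1 + ∫₀ʳ x B x g / B
r g dx`, and total positivity makes the integrand strictly decreasing in `g` for `0 < x < r`. Hence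
`c` times this quotient, once at most `1`, is below `1` from there on. -/
theorem normalBandProb_single_crossing {r c a b : ℝ} (hr : 0 < r) (hc : 0 < c) (ha : 0 < a)
    (hab : a < b)
    (h : c * (a * normalBandProb r a) ≤ stdNormalPDF (r - a) - stdNormalPDF (r + a)) :
    c * (b * normalBandProb r b) < stdNormalPDF (r - b) - stdNormalPDF (r + b) := by
  have hA := mul_normalBandProb_sub_eq_integral r a
  have hB := mul_normalBandProb_sub_eq_integral r b
  have hBa := stdNormalPDF_sub_sub_add_pos hr ha
  have hBb := stdNormalPDF_sub_sub_add_pos hr (ha.trans hab)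
  have key : (∫ x in (0 : ℝ)..r, x * (stdNormalPDF (x - b) - stdNormalPDF (x + b)) *
        (stdNormalPDF (r - a) - stdNormalPDF (r + a))) <
      ∫ x in (0 : ℝ)..r, x * (stdNormalPDF (x - a) - stdNormalPDF (x + a)) *
        (stdNormalPDF (r - b) - stdNormalPDF (r + b)) := by
    have hlt : ∀ x, 0 < x → x < r → x * (stdNormalPDF (x - b) - stdNormalPDF (x + b)) *
        (stdNormalPDF (r - a) - stdNormalPDF (r + a)) <
        x * (stdNormalPDF (x - a) - stdNormalPDF (x + a)) *
        (stdNormalPDF (r - b) - stdNormalPDF (r + b)) := by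
      intro x hx hxr
      rw [mul_assoc, mul_assoc]
      exact mul_lt_mul_of_pos_left (stdNormalPDF_sub_sub_add_mul_lt ha hab hx hxr) hx
    refine intervalIntegral.integral_lt_integral_of_continuousOn_of_le_of_exists_lt hr
      (Continuous.continuousOn (by fun_prop)) (Continuous.continuousOn (by fun_prop)) ?_
      ⟨r / 2, ⟨by linarith, by linarith⟩, hlt _ (by linarith) (by linarith)⟩
    intro x hx
    rcases hx.2.eq_or_lt with rfl | hxr
    · exact le_of_eq (by ring)
    · exact (hlt x hx.1 hxr).le
  rw [intervalIntegral.integral_mul_const, intervalIntegral.integral_mul_const, ← hA, ← hB] at key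
  set Ba := stdNormalPDF (r - a) - stdNormalPDF (r + a)
  set Bb := stdNormalPDF (r - b) - stdNormalPDF (r + b)
  by_contra! hcon
  nlinarith [mul_le_mul_of_nonneg_right h hBb.le, mul_le_mul_of_nonneg_right hcon hBa.le,
    mul_lt_mul_of_pos_left key hc]

theorem normalBandProb_le_zero {r g : ℝ} (hr : 0 < r) (hg : 0 ≤ g) :
    normalBandProb r g ≤ normalBandProb r 0 := by
  have : AntitoneOn (normalBandProb r) (Ici 0) := by
    refine antitoneOn_of_hasDerivWithinAt_nonpos (convex_Ici 0)
      (fun t _ => (hasDerivAt_normalBandProb r t).continuousAt.continuousWithinAt)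
      (fun t _ => (hasDerivAt_normalBandProb r t).hasDerivWithinAt) ?_
    intro t ht
    rw [interior_Ici, mem_Ioi] at ht
    linarith [stdNormalPDF_sub_sub_add_pos hr ht]
  exact this self_mem_Ici hg hg

/-! ### The tail of a smoothed uniform law. -/

/-- An antiderivative of `Φ`. -/
def stdNormalCDFPrimitive (t : ℝ) : ℝ := t * stdNormalCDF t + stdNormalPDF t

theorem hasDerivAt_stdNormalCDFPrimitive (t : ℝ) :
    HasDerivAt stdNormalCDFPrimitive (stdNormalCDF t) t := by
  convert! ((hasDerivAt_id t).mul (hasDerivAt_stdNormalCDF t)).add (hasDerivAt_stdNormalPDF t)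
    using 1
  simp

theorem stdNormalCDFPrimitive_neg (t : ℝ) :
    stdNormalCDFPrimitive (-t) = stdNormalCDFPrimitive t - t := by
  simp only [stdNormalCDFPrimitive, stdNormalCDF_neg, stdNormalPDF_neg]
  ring

/-- The average of `Φ` over `[-r - g, r - g]`. -/
def averageCDF (r g : ℝ) : ℝ := ∫ x in (0 : ℝ)..1, stdNormalCDF (2 * r * x - r - g)

theorem averageCDF_eq {r : ℝ} (hr : r ≠ 0) (g : ℝ) :
    averageCDF r g =
      (stdNormalCDFPrimitive (r - g) - stdNormalCDFPrimitive (-r - g)) / (2 * r) := by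
  have hd : ∀ x : ℝ, HasDerivAt (fun x => stdNormalCDFPrimitive (2 * r * x - r - g) / (2 * r))
      (stdNormalCDF (2 * r * x - r - g)) x := by
    intro x
    have h1 : HasDerivAt (fun x => 2 * r * x - r - g) (2 * r) x := by
      simpa using (((hasDerivAt_id x).const_mul (2 * r)).sub_const r).sub_const g
    convert! ((hasDerivAt_stdNormalCDFPrimitive _).comp x h1).div_const (2 * r) using 1
    field_simp
  rw [averageCDF, intervalIntegral.integral_eq_sub_of_hasDerivAt (fun x _ => hd x)
    (Continuous.intervalIntegrable (by fun_prop) _ _)]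
  rw [show 2 * r * 1 - r - g = r - g by ring, show 2 * r * 0 - r - g = -r - g by ring, sub_div]

theorem hasDerivAt_averageCDF {r : ℝ} (hr : r ≠ 0) (g : ℝ) :
    HasDerivAt (averageCDF r) (-(normalBandProb r g / (2 * r))) g := by
  rw [show averageCDF r = _ from funext (averageCDF_eq hr)]
  have h1 := (hasDerivAt_stdNormalCDFPrimitive (r - g)).comp g ((hasDerivAt_id g).const_sub r)
  have h2 := (hasDerivAt_stdNormalCDFPrimitive (-r - g)).comp g ((hasDerivAt_id g).const_sub (-r))
  convert! (h1.sub h2).div_const (2 * r) using 1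
  rw [normalBandProb]
  ring

theorem averageCDF_neg {r : ℝ} (hr : r ≠ 0) (g : ℝ) :
    averageCDF r (-g) = 1 - averageCDF r g := by
  rw [averageCDF_eq hr, averageCDF_eq hr, show r - -g = -(-r - g) by ring,
    show -r - -g = -(r - g) by ring, stdNormalCDFPrimitive_neg, stdNormalCDFPrimitive_neg]
  field_simp
  ring

theorem averageCDF_zero {r : ℝ} (hr : r ≠ 0) : averageCDF r 0 = 1 / 2 := by
  have h := averageCDF_neg hr 0
  rw [neg_zero] at h
  linarith

theorem averageCDF_le {r : ℝ} (hr : 0 < r) (g : ℝ) : averageCDF r g ≤ stdNormalCDF (r - g) := by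
  have h := intervalIntegral.integral_mono_on (μ := volume) (zero_le_one' ℝ)
    (f := fun x => stdNormalCDF (2 * r * x - r - g)) (g := fun _ => stdNormalCDF (r - g))
    (Continuous.intervalIntegrable (by fun_prop) _ _) (by simp)
    (fun x hx => monotone_stdNormalCDF (by nlinarith [hx.2]))
  simpa [averageCDF] using h

theorem averageCDF_nonneg (r g : ℝ) : 0 ≤ averageCDF r g :=
  intervalIntegral.integral_nonneg zero_le_one fun _ _ => (stdNormalCDF_mem_Icc _).1

theorem tendsto_averageCDF_atTop {r : ℝ} (hr : 0 < r) :
    Tendsto (averageCDF r) atTop (𝓝 0) := by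
  refine squeeze_zero (averageCDF_nonneg r) (averageCDF_le hr) ?_
  exact tendsto_stdNormalCDF_atBot.comp (tendsto_atBot_add_const_left _ r tendsto_neg_atTop_atBot)

/-- The tail falls fastest at `0`, where its density peaks, so it stays above its tangent there. -/
theorem le_averageCDF {r g : ℝ} (hr : 0 < r) (hg : 0 ≤ g) :
    1 / 2 - g * (normalBandProb r 0 / (2 * r)) ≤ averageCDF r g := by
  have hd : ∀ t, HasDerivAt (fun t => averageCDF r t + t * (normalBandProb r 0 / (2 * r)))
      (-(normalBandProb r t / (2 * r)) + normalBandProb r 0 / (2 * r)) t := by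
    intro t
    convert! (hasDerivAt_averageCDF hr.ne' t).add
      ((hasDerivAt_id t).mul_const (normalBandProb r 0 / (2 * r))) using 1
    rw [one_mul]
  have : MonotoneOn (fun t => averageCDF r t + t * (normalBandProb r 0 / (2 * r))) (Ici 0) := by
    refine monotoneOn_of_hasDerivWithinAt_nonneg (convex_Ici 0)
      (fun t _ => (hd t).continuousAt.continuousWithinAt)
      (fun t _ => (hd t).hasDerivWithinAt) ?_
    intro t ht
    rw [interior_Ici, mem_Ioi] at ht
    have := div_le_div_of_nonneg_right (normalBandProb_le_zero hr ht.le) (by positivity : 0 ≤ 2 * r)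
    linarith
  have h := this self_mem_Ici hg hg
  simp only [averageCDF_zero hr.ne'] at h
  linarith

/-! ### Comparison of the two tails. -/

/-- A normal law with standard deviation `s` has a heavier upper tail than the convolution of the
uniform law on `[-r, r]` with the standard normal law, if their densities agree at `0`. -/
theorem averageCDF_lt {r s g : ℝ} (hr : 0 < r) (hs : 0 < s)
    (h0 : normalBandProb r 0 / (2 * r) = stdNormalPDF 0 / s) (hg : 0 < g) :
    averageCDF r g < stdNormalCDF (-(g / s)) := by
  set D : ℝ → ℝ := fun t => stdNormalCDF (-(t / s)) - averageCDF r t with hD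
  set D' : ℝ → ℝ := fun t => normalBandProb r t / (2 * r) - stdNormalPDF (t / s) / s with hD'
  have hDd : ∀ t, HasDerivAt D (D' t) t := by
    intro t
    have h1 := (hasDerivAt_stdNormalCDF (-(t / s))).comp t ((hasDerivAt_id t).div_const s).neg
    convert! h1.sub (hasDerivAt_averageCDF hr.ne' t) using 1
    simp only [hD', stdNormalPDF_neg]
    ring
  have hDlim : Tendsto D atTop (𝓝 0) := by
    have h1 : Tendsto (fun t => stdNormalCDF (-(t / s))) atTop (𝓝 0) :=
      tendsto_stdNormalCDF_atBot.comp
        (tendsto_neg_atTop_atBot.comp (tendsto_id.atTop_div_const hs))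
    simpa using h1.sub (tendsto_averageCDF_atTop hr)
  have hD0 : D 0 = 0 := by simp [hD, averageCDF_zero hr.ne', stdNormalCDF_zero]
  -- the density ratio, up to a constant
  set Q : ℝ → ℝ := fun t => normalBandProb r t * Real.exp (t ^ 2 / (2 * s ^ 2)) with hQ
  set N : ℝ → ℝ := fun t => (s ^ 2)⁻¹ * (t * normalBandProb r t) -
    (stdNormalPDF (r - t) - stdNormalPDF (r + t)) with hN
  have hQd : ∀ t, HasDerivAt Q (Real.exp (t ^ 2 / (2 * s ^ 2)) * N t) t := by
    intro t
    have h1 : HasDerivAt (fun t : ℝ => t ^ 2 / (2 * s ^ 2)) ((s ^ 2)⁻¹ * t) t := by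
      convert! (hasDerivAt_pow 2 t).div_const (2 * s ^ 2) using 1
      field_simp
      simp [mul_comm]
    convert! (hasDerivAt_normalBandProb r t).mul h1.exp using 1
    simp only [hN]
    ring
  -- Equality of the densities at `0` is what makes `D'` have the sign of `Q - Q 0`.
  have hsign : ∀ t, D' t = (Q t - Q 0) * (Real.exp (-(t ^ 2 / (2 * s ^ 2))) / (2 * r)) := by
    intro t
    have h1 : stdNormalPDF (t / s) = stdNormalPDF 0 * Real.exp (-(t ^ 2 / (2 * s ^ 2))) := by
      rw [stdNormalPDF_eq, stdNormalPDF_eq]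
      simp only [ne_eq, OfNat.ofNat_ne_zero, not_false_eq_true, zero_pow, neg_zero, zero_div,
        Real.exp_zero, mul_one]
      congr 2
      field_simp
    have h2 : Real.exp (t ^ 2 / (2 * s ^ 2)) * Real.exp (-(t ^ 2 / (2 * s ^ 2))) = 1 := by
      rw [← Real.exp_add]; simp
    have h3 : stdNormalPDF (t / s) / s =
        normalBandProb r 0 / (2 * r) * Real.exp (-(t ^ 2 / (2 * s ^ 2))) := by
      rw [h0, h1]; ring
    simp only [hD', h3, hQ]
    have h4 : normalBandProb r t / (2 * r) = normalBandProb r t / (2 * r) *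
      (Real.exp (t ^ 2 / (2 * s ^ 2)) * Real.exp (-(t ^ 2 / (2 * s ^ 2)))) := by rw [h2, mul_one]
    rw [h4]
    simp
    ring
  -- If `D g ≤ 0 = D 0`, then `D' p ≤ 0` for some `p` in `(0, g)`, hence `Q p ≤ Q 0` and `Q' c ≤ 0`
  -- for some `c` in `(0, p)`. By single crossing `Q` decreases beyond `c`, so `D` decreases
  -- strictly beyond `p` and cannot climb back to its limit `0`.
  by_contra! hcon
  have hDg : D g ≤ 0 := by simp only [hD]; linarith
  obtain ⟨p, hp, hpd⟩ := exists_hasDerivAt_eq_slope D D' hg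
    (fun t _ => (hDd t).continuousAt.continuousWithinAt) (fun t _ => hDd t)
  have hp' : D' p ≤ 0 := by
    rw [hpd, hD0]
    exact div_nonpos_of_nonpos_of_nonneg (by linarith) (by linarith)
  have hQp : Q p ≤ Q 0 := by
    rw [hsign] at hp'
    have : 0 < Real.exp (-(p ^ 2 / (2 * s ^ 2))) / (2 * r) := by positivity
    nlinarith
  obtain ⟨c, hc, hcd⟩ := exists_hasDerivAt_eq_slope Q _ hp.1
    (fun t _ => (hQd t).continuousAt.continuousWithinAt) (fun t _ => hQd t)
  have hNc : N c ≤ 0 := by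
    have h1 : Real.exp (c ^ 2 / (2 * s ^ 2)) * N c ≤ 0 := by
      rw [hcd]
      exact div_nonpos_of_nonpos_of_nonneg (by linarith) (by linarith [hp.1])
    have := Real.exp_pos (c ^ 2 / (2 * s ^ 2))
    by_contra! h
    linarith [mul_pos this h]
  have hNneg : ∀ t, c < t → N t < 0 := fun t ht => sub_neg.2
    (normalBandProb_single_crossing hr (by positivity) hc.1 ht (sub_nonpos.1 hNc))
  have hQanti : StrictAntiOn Q (Ici p) := by
    refine strictAntiOn_of_hasDerivWithinAt_neg (convex_Ici p)
      (fun t _ => (hQd t).continuousAt.continuousWithinAt)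
      (fun t _ => (hQd t).hasDerivWithinAt) ?_
    intro t ht
    rw [interior_Ici, mem_Ioi] at ht
    exact mul_neg_of_pos_of_neg (Real.exp_pos _) (hNneg t (hc.2.trans ht))
  have hDanti : StrictAntiOn D (Ici p) := by
    refine strictAntiOn_of_hasDerivWithinAt_neg (convex_Ici p)
      (fun t _ => (hDd t).continuousAt.continuousWithinAt)
      (fun t _ => (hDd t).hasDerivWithinAt) ?_
    intro t ht
    rw [interior_Ici, mem_Ioi] at ht
    rw [hsign]
    have := hQanti self_mem_Ici ht.le ht
    exact mul_neg_of_neg_of_pos (by linarith) (by positivity)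
  -- Any point past `g` serves here: it makes `D` strictly negative.
  have hg1 : D (g + 1) < D g := hDanti hp.2.le (by simp; linarith [hp.2]) (by linarith)
  have hfin : (0 : ℝ) ≤ D (g + 1) := by
    refine le_of_tendsto hDlim ?_
    filter_upwards [eventually_ge_atTop (g + 1)] with t ht
    exact hDanti.antitoneOn (by simp; linarith [hp.2]) (by simp; linarith [hp.2]) ht
  linarith

/-! ### The condition of (i) always holds. -/

/-- Jensen's inequality for `exp`: the mean of `x²/2` over `[-r, r]` is `r²/6`. It is proved by `1 +
u ≤ exp u` with `u = r²/6 - x²/2`, which has mean zero. -/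
theorem exp_mul_stdNormalPDF_zero_le {r : ℝ} (hr : 0 < r) :
    Real.exp (-r ^ 2 / 6) * stdNormalPDF 0 ≤ normalBandProb r 0 / (2 * r) := by
  rw [le_div_iff₀ (by positivity), normalBandProb, sub_zero, sub_zero, stdNormalCDF_sub]
  have h : ∀ x ∈ Icc (-r) r,
      stdNormalPDF 0 * Real.exp (-r ^ 2 / 6) * (1 + r ^ 2 / 6 - x ^ 2 / 2) ≤ stdNormalPDF x := by
    intro x _
    have h1 : stdNormalPDF x = stdNormalPDF 0 * Real.exp (-r ^ 2 / 6) *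
        Real.exp (r ^ 2 / 6 - x ^ 2 / 2) := by
      rw [stdNormalPDF_eq, stdNormalPDF_eq, mul_assoc, mul_assoc, ← Real.exp_add, ← Real.exp_add]
      congr 2
      ring
    rw [h1]
    refine mul_le_mul_of_nonneg_left ?_ (mul_pos (stdNormalPDF_pos 0) (Real.exp_pos _)).le
    linarith [Real.add_one_le_exp (r ^ 2 / 6 - x ^ 2 / 2)]
  have h2 := intervalIntegral.integral_mono_on (μ := volume) (by linarith : -r ≤ r)
    (Continuous.intervalIntegrable (by fun_prop) _ _)
    (Continuous.intervalIntegrable (by fun_prop) _ _) h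
  refine le_trans (le_of_eq ?_) h2
  rw [intervalIntegral.integral_const_mul, intervalIntegral.integral_sub (by simp)
    (Continuous.intervalIntegrable (by fun_prop) _ _), intervalIntegral.integral_const,
    intervalIntegral.integral_div, integral_pow]
  simp
  ring

/-- The Jensen bound says `exp(-r²/6) s ≤ 1`; its cube is the claim. -/
theorem stdNormalPDF_mul_pow_three_le {r s : ℝ} (hr : 0 < r) (hs : 0 < s)
    (h0 : normalBandProb r 0 / (2 * r) = stdNormalPDF 0 / s) :
    stdNormalPDF r * s ^ 3 ≤ stdNormalPDF 0 := by
  have h1 := exp_mul_stdNormalPDF_zero_le hr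
  have hφ := stdNormalPDF_pos 0
  rw [h0, le_div_iff₀ hs] at h1
  have h2 : Real.exp (-r ^ 2 / 6) * s ≤ 1 := by nlinarith
  have h3 : stdNormalPDF r = stdNormalPDF 0 * Real.exp (-r ^ 2 / 6) ^ 3 := by
    rw [stdNormalPDF_eq, stdNormalPDF_eq, ← Real.exp_nat_mul, mul_assoc, ← Real.exp_add]
    congr 2
    push_cast
    ring
  rw [h3, mul_assoc, ← mul_pow]
  exact mul_le_of_le_one_right hφ.le (pow_le_one₀ (by positivity) h2)

/-! ### Existence and uniqueness of the cutoff. -/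

theorem normalBandProb_zero (r : ℝ) : normalBandProb r 0 = 1 - 2 * stdNormalCDF (-r) := by
  have := stdNormalCDF_neg r
  rw [normalBandProb, sub_zero, sub_zero]
  linarith

/-- Pulling out the factor `r` turns the equation for the cutoff into a level equation for a
strictly decreasing continuous function. -/
theorem normalBandProb_zero_eq_integral (r : ℝ) :
    normalBandProb r 0 = 2 * r * ∫ x in (0 : ℝ)..1, stdNormalPDF (r * x) := by
  have h := intervalIntegral.smul_integral_comp_mul_left stdNormalPDF r (a := 0) (b := 1)
  rw [mul_zero, mul_one, ← stdNormalCDF_sub, smul_eq_mul, stdNormalCDF_zero] at h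
  rw [mul_assoc, h, normalBandProb_zero, stdNormalCDF_neg]
  ring

theorem strictAntiOn_integral_stdNormalPDF_mul :
    StrictAntiOn (fun r => ∫ x in (0 : ℝ)..1, stdNormalPDF (r * x)) (Ici 0) := by
  intro a ha b _ hab
  have ha : 0 ≤ a := ha
  have h : ∀ x : ℝ, 0 < x → stdNormalPDF (b * x) < stdNormalPDF (a * x) := by
    intro x hx
    rw [stdNormalPDF_eq, stdNormalPDF_eq]
    have : (a * x) ^ 2 < (b * x) ^ 2 :=
      pow_lt_pow_left₀ (mul_lt_mul_of_pos_right hab hx) (by positivity) two_ne_zero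
    have : Real.exp (-(b * x) ^ 2 / 2) < Real.exp (-(a * x) ^ 2 / 2) :=
      Real.exp_lt_exp.2 (by linarith)
    exact mul_lt_mul_of_pos_left this (by positivity)
  exact intervalIntegral.integral_lt_integral_of_continuousOn_of_le_of_exists_lt one_pos
    (Continuous.continuousOn (by fun_prop)) (Continuous.continuousOn (by fun_prop))
    (fun x hx => (h x hx.1).le) ⟨1, by simp, h 1 one_pos⟩

theorem continuous_integral_stdNormalPDF_mul :
    Continuous (fun r => ∫ x in (0 : ℝ)..1, stdNormalPDF (r * x)) :=
  intervalIntegral.continuous_parametric_intervalIntegral_of_continuous' (by fun_prop) 0 1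

/-- The equation `r c = ℙ(|Z| ≤ r)` has exactly one positive solution if `c < 2 φ(0)`. -/
theorem existsUnique_normalBandProb_zero_eq {c : ℝ} (hc : 0 < c) (hc' : c < 2 * stdNormalPDF 0) :
    ∃! r : ℝ, 0 < r ∧ r * c = normalBandProb r 0 := by
  set ψ : ℝ → ℝ := fun r => ∫ x in (0 : ℝ)..1, stdNormalPDF (r * x) with hψ
  have hiff : ∀ r : ℝ, 0 < r → (r * c = normalBandProb r 0 ↔ ψ r = c / 2) := by
    intro r hr
    rw [normalBandProb_zero_eq_integral]
    constructor
    · intro h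
      have : r * (c - 2 * ψ r) = 0 := by simp only [hψ]; linarith
      rcases mul_eq_zero.1 this with h | h <;> linarith
    · intro h
      simp only [hψ] at h
      rw [h]; ring
  -- At `r = 1/c` the line `r c` reaches `1`, which exceeds the band probability.
  have hlow : ψ (1 / c) < c / 2 := by
    have h1 := normalBandProb_zero_eq_integral (1 / c)
    have h2 : normalBandProb (1 / c) 0 < 1 := by
      have : 0 < stdNormalCDF (-(1 / c)) :=
        (stdNormalCDF_mem_Icc (-(1 / c) - 1)).1.trans_lt (strictMono_stdNormalCDF (by linarith))
      rw [normalBandProb_zero]; linarith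
    have h3 : 2 * (1 / c) * ψ (1 / c) < 1 := by simp only [hψ]; linarith
    have h4 : 2 * (1 / c) * ψ (1 / c) = ψ (1 / c) / (c / 2) := by field_simp
    rwa [h4, div_lt_one (by positivity)] at h3
  have hup : c / 2 < ψ 0 := by simp [hψ]; linarith
  obtain ⟨r, hr, hre⟩ := intermediate_value_Ioo' (by positivity : (0 : ℝ) ≤ 1 / c)
    continuous_integral_stdNormalPDF_mul.continuousOn ⟨hlow, hup⟩
  refine ⟨r, ⟨hr.1, (hiff r hr.1).2 hre⟩, ?_⟩
  rintro t ⟨ht, hte⟩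
  exact strictAntiOn_integral_stdNormalPDF_mul.injOn ht.le hr.1.le
    (((hiff t ht).1 hte).trans hre.symm)

/-! ### Profiled regrets and their comparison. -/

namespace EvidenceAggregation

variable {d n : ℕ} [NeZero n] (E : EvidenceAggregation d n)

theorem σ₁_pos : 0 < E.σ₁ := E.σ_pos 0

theorem posSemidef_cov : E.cov.PosSemidef :=
  Matrix.PosSemidef.diagonal fun _ => sq_nonneg _

theorem inner_wStar_m (θ : EuclideanSpace ℝ (Fin d) → ℝ) :
    inner ℝ (wStar n) (E.m θ) = θ (E.x 0) := by
  rw [inner_wStar, m]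

theorem expectedAction_ofIndex_wStar {f : ℝ → ℝ} (hf : Measurable f)
    (hf01 : ∀ t, f t ∈ Icc (0 : ℝ) 1) (θ : EuclideanSpace ℝ (Fin d) → ℝ) :
    E.expectedAction (DecisionRule.ofIndex (wStar n) f hf hf01) θ =
      ∫ t, f t ∂gaussianReal (θ (E.x 0)) (E.σ₁ ^ 2).toNNReal := by
  have h := measurePreserving_eval_multivariateGaussian (μ := E.m θ) E.posSemidef_cov (i := 0)
  have h2 : gaussianReal (θ (E.x 0)) (E.σ₁ ^ 2).toNNReal =
      gaussianReal (E.m θ 0) (E.cov 0 0).toNNReal := by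
    simp [m, cov, σ₁]
  rw [h2, ← h.map_eq, integral_map h.measurable.aemeasurable hf.aestronglyMeasurable]
  simp only [expectedAction, DecisionRule.ofIndex, inner_wStar]

theorem regret_eq (δ : DecisionRule n) (θ : EuclideanSpace ℝ (Fin d) → ℝ) :
    E.regret δ θ = max (E.U θ) 0 - E.U θ * E.expectedAction δ θ := by
  unfold regret
  split_ifs with h
  · rw [max_eq_left h]; ring
  · rw [max_eq_right (not_le.1 h).le]; ring

theorem abs_U_sub_le {θ : EuclideanSpace ℝ (Fin d) → ℝ} (hθ : θ ∈ E.Θ) :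
    |E.U θ - θ (E.x 0)| ≤ E.k := by
  have h := LipschitzWith.dist_le_mul hθ E.x₀ (E.x 0)
  rwa [dist_comm E.x₀, dist_eq_norm (E.x 0), Real.dist_eq] at h

/-- The extremes are attained by the cones of slope `±C` with apex at `x₁`. -/
theorem exists_mem_Θ_U_eq (γ : ℝ) {u : ℝ} (hu : u = γ + E.k ∨ u = γ - E.k) :
    ∃ θ ∈ E.Θ, θ (E.x 0) = γ ∧ E.U θ = u := by
  have key : ∀ c : ℝ, |c| = E.C → (fun z => γ + c * ‖E.x 0 - z‖) ∈ E.Θ := by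
    intro c hc
    refine LipschitzWith.of_dist_le_mul fun y z => ?_
    rw [Real.dist_eq, show γ + c * ‖E.x 0 - y‖ - (γ + c * ‖E.x 0 - z‖) =
      c * (‖E.x 0 - y‖ - ‖E.x 0 - z‖) by ring, abs_mul, hc]
    refine mul_le_mul_of_nonneg_left ?_ E.C.2
    refine (abs_norm_sub_norm_le _ _).trans (le_of_eq ?_)
    rw [sub_sub_sub_cancel_left, dist_comm, dist_eq_norm]
  rcases hu with rfl | rfl
  · exact ⟨_, key E.C (NNReal.abs_eq _), by simp, by simp [U, k]⟩
  · exact ⟨_, key (-E.C) (by rw [abs_neg, NNReal.abs_eq]), by simp, by simp [U, k]; ring⟩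

/-- The profiled regret of a rule whose expected action is determined by the mean of the nearest
neighbor. -/
theorem profiledRegret_wStar_eq {δ : DecisionRule n} {γ p : ℝ}
    (hp : ∀ θ, θ (E.x 0) = γ → E.expectedAction δ θ = p) (hp01 : p ∈ Icc (0 : ℝ) 1) :
    E.profiledRegret (wStar n) δ γ = max ((γ + E.k) * (1 - p)) ((E.k - γ) * p) := by
  have hlub := E.isLUB_profiledRegret δ γ
  refine le_antisymm (hlub.2 ?_) (max_le ?_ ?_)
  · rintro r ⟨θ, hθ, hγ, rfl⟩
    rw [inner_wStar_m] at hγ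
    have hU := abs_le.1 (E.abs_U_sub_le hθ)
    rw [hγ] at hU
    rw [regret_eq, hp θ hγ]
    rcases le_total 0 (E.U θ) with h | h
    · refine le_max_of_le_left ?_
      rw [max_eq_left h]
      nlinarith [hp01.2]
    · refine le_max_of_le_right ?_
      rw [max_eq_right h]
      nlinarith [hp01.1]
  -- The sign of `u = γ + k` is irrelevant, since `max u 0 - u p ≥ u (1 - p)`.
  · obtain ⟨θ, hθ, hγ, hU⟩ := E.exists_mem_Θ_U_eq γ (Or.inl rfl)
    refine le_trans ?_ (hlub.1 ⟨θ, hθ, (E.inner_wStar_m θ).trans hγ, rfl⟩)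
    rw [regret_eq, hp θ hγ, hU]
    linarith [le_max_left (γ + E.k) 0]
  · obtain ⟨θ, hθ, hγ, hU⟩ := E.exists_mem_Θ_U_eq γ (Or.inr rfl)
    refine le_trans ?_ (hlub.1 ⟨θ, hθ, (E.inner_wStar_m θ).trans hγ, rfl⟩)
    rw [regret_eq, hp θ hγ, hU]
    linarith [le_max_right (γ - E.k) 0]

theorem profiledRegret_dLinear {ρ : ℝ} (hρ : 0 < ρ) (γ : ℝ) :
    E.profiledRegret (wStar n) (dLinear n ρ) γ =
      max ((γ + E.k) * averageCDF (ρ / E.σ₁) (γ / E.σ₁))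
        ((E.k - γ) * (1 - averageCDF (ρ / E.σ₁) (γ / E.σ₁))) := by
  have hσ := E.σ₁_pos
  have h : ∀ θ, θ (E.x 0) = γ →
      E.expectedAction (dLinear n ρ) θ = 1 - averageCDF (ρ / E.σ₁) (γ / E.σ₁) := by
    rintro θ rfl
    rw [dLinear, expectedAction_ofIndex_wStar, integral_piecewiseLinear _ hσ hρ, averageCDF]
    congr! 4
    field_simp
  rw [E.profiledRegret_wStar_eq h, sub_sub_cancel]
  have h1 := averageCDF_nonneg (ρ / E.σ₁) (γ / E.σ₁)
  have h2 := (averageCDF_le (div_pos hρ hσ) (γ / E.σ₁)).trans (stdNormalCDF_mem_Icc _).2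
  constructor <;> linarith

theorem profiledRegret_dRT (hk : √(Real.pi / 2) * E.σ₁ < E.k) (γ : ℝ) :
    E.profiledRegret (wStar n) E.dRT γ =
      max ((γ + E.k) * stdNormalCDF (-(γ / (E.k / √(Real.pi / 2)))))
        ((E.k - γ) * (1 - stdNormalCDF (-(γ / (E.k / √(Real.pi / 2)))))) := by
  have hσ := E.σ₁_pos
  have hπ : 0 < √(Real.pi / 2) := by positivity
  have hk0 : 0 < E.k := (by positivity : 0 < √(Real.pi / 2) * E.σ₁).trans hk
  have hsq : (E.k / √(Real.pi / 2)) ^ 2 = 2 * E.k ^ 2 / Real.pi := by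
    rw [div_pow, Real.sq_sqrt (by positivity)]
    field_simp
  have hlt : 0 < 2 * E.k ^ 2 / Real.pi - E.σ₁ ^ 2 := by
    rw [← hsq, sub_pos]
    refine pow_lt_pow_left₀ ?_ hσ.le two_ne_zero
    rw [lt_div_iff₀ hπ]; linarith
  have hτ : 0 < E.σTilde := Real.sqrt_pos.2 hlt
  -- `σ̃` is chosen so that the total variance is `2k²/π`, free of `σ₁`.
  have hsum : √(E.σ₁ ^ 2 + E.σTilde ^ 2) = E.k / √(Real.pi / 2) := by
    rw [σTilde, Real.sq_sqrt hlt.le, add_sub_cancel, ← hsq, Real.sqrt_sq (by positivity)]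
  have h : ∀ θ, θ (E.x 0) = γ →
      E.expectedAction E.dRT θ = 1 - stdNormalCDF (-(γ / (E.k / √(Real.pi / 2)))) := by
    rintro θ rfl
    rw [dRT, expectedAction_ofIndex_wStar, integral_stdNormalCDF_div _ hσ hτ, hsum,
      stdNormalCDF_neg, sub_sub_cancel]
  rw [E.profiledRegret_wStar_eq h, sub_sub_cancel]
  have h1 := stdNormalCDF_mem_Icc (-(γ / (E.k / √(Real.pi / 2))))
  constructor <;> linarith [h1.1, h1.2]

theorem IsRhoStar.normalBandProb_eq {E : EvidenceAggregation d n} {ρ : ℝ} (h : E.IsRhoStar ρ) :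
    normalBandProb (ρ / E.σ₁) 0 / (2 * (ρ / E.σ₁)) = E.σ₁ / (2 * E.k) := by
  obtain ⟨h0, hk, he⟩ := h
  have hσ := E.σ₁_pos
  have hk0 : 0 < E.k := h0.trans hk
  rw [normalBandProb_zero, ← neg_div]
  have : 1 - 2 * stdNormalCDF (-ρ / E.σ₁) = ρ / E.k := by
    rw [eq_div_iff hk0.ne']; linarith
  rw [this]
  field_simp

theorem stdNormalPDF_zero_eq : stdNormalPDF 0 = 1 / (2 * √(Real.pi / 2)) := by
  rw [stdNormalPDF_eq]
  have : √(2 * Real.pi) = 2 * √(Real.pi / 2) := by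
    rw [show 2 * Real.pi = 2 ^ 2 * (Real.pi / 2) by ring, Real.sqrt_mul (by positivity),
      Real.sqrt_sq (by positivity)]
  simp [this]

theorem existsUnique_isRhoStar (hk : √(Real.pi / 2) * E.σ₁ < E.k) : ∃! ρ : ℝ, E.IsRhoStar ρ := by
  have hσ := E.σ₁_pos
  have hπ : 0 < √(Real.pi / 2) := by positivity
  have hk0 : 0 < E.k := (by positivity : 0 < √(Real.pi / 2) * E.σ₁).trans hk
  -- This is `hk` rewritten, as `2 φ(0) = 1/√(π/2)`.
  have hc : E.σ₁ / E.k < 2 * stdNormalPDF 0 := by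
    rw [stdNormalPDF_zero_eq, div_lt_iff₀ hk0]
    field_simp
    linarith
  obtain ⟨r, ⟨hr, hre⟩, huniq⟩ := existsUnique_normalBandProb_zero_eq (div_pos hσ hk0) hc
  rw [normalBandProb_zero] at hre
  have hpos : 0 < stdNormalCDF (-r) :=
    (stdNormalCDF_mem_Icc (-r - 1)).1.trans_lt (strictMono_stdNormalCDF (by linarith))
  have heq : r * E.σ₁ = E.k * (1 - 2 * stdNormalCDF (-r)) := by
    rw [← hre]; field_simp
  refine ⟨r * E.σ₁, ⟨by positivity, by nlinarith, ?_⟩, ?_⟩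
  · rwa [neg_div, mul_div_cancel_right₀ _ hσ.ne']
  · rintro ρ ⟨h0, -, he⟩
    rw [← huniq (ρ / E.σ₁) ⟨by positivity, ?_⟩, div_mul_cancel₀ _ hσ.ne']
    rw [normalBandProb_zero, ← neg_div, div_mul_div_cancel₀ hσ.ne', div_eq_iff hk0.ne']
    linarith

/-- The equation for `ρ*` is the equality of densities at `0` that the tail comparison requires. -/
theorem IsRhoStar.normalBandProb_eq_stdNormalPDF {E : EvidenceAggregation d n} {ρ : ℝ}
    (h : E.IsRhoStar ρ) :
    normalBandProb (ρ / E.σ₁) 0 / (2 * (ρ / E.σ₁)) =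
      stdNormalPDF 0 / (E.k / (√(Real.pi / 2) * E.σ₁)) := by
  have hπ : 0 < √(Real.pi / 2) := by positivity
  have hk0 : 0 < E.k := h.1.trans h.2.1
  have hσ := E.σ₁_pos
  rw [h.normalBandProb_eq, stdNormalPDF_zero_eq]
  field_simp

/-- The condition of part (i) holds for every problem with `k > √(π / 2) σ₁`, so that the condition
of part (ii) never does. -/
theorem IsRhoStar.stdNormalPDF_mul_pow_three_le {E : EvidenceAggregation d n} {ρ : ℝ}
    (h : E.IsRhoStar ρ) :
    stdNormalPDF (ρ / E.σ₁) * (E.k / (√(Real.pi / 2) * E.σ₁)) ^ 3 ≤ stdNormalPDF 0 := by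
  have hk0 : 0 < E.k := h.1.trans h.2.1
  have hσ := E.σ₁_pos
  exact _root_.stdNormalPDF_mul_pow_three_le (div_pos h.1 hσ) (by positivity)
    h.normalBandProb_eq_stdNormalPDF

theorem profiledRegret_dLinear_neg {ρ : ℝ} (hρ : 0 < ρ) (γ : ℝ) :
    E.profiledRegret (wStar n) (dLinear n ρ) (-γ) =
      E.profiledRegret (wStar n) (dLinear n ρ) γ := by
  rw [E.profiledRegret_dLinear hρ, E.profiledRegret_dLinear hρ, neg_div,
    averageCDF_neg (div_pos hρ E.σ₁_pos).ne', sub_sub_cancel, max_comm, sub_neg_eq_add,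
    neg_add_eq_sub, add_comm E.k]

theorem profiledRegret_dRT_neg (hk : √(Real.pi / 2) * E.σ₁ < E.k) (γ : ℝ) :
    E.profiledRegret (wStar n) E.dRT (-γ) = E.profiledRegret (wStar n) E.dRT γ := by
  rw [E.profiledRegret_dRT hk, E.profiledRegret_dRT hk, neg_div,
    stdNormalCDF_neg (-(γ / _)), sub_sub_cancel, max_comm, sub_neg_eq_add,
    neg_add_eq_sub, add_comm E.k]

theorem profiledRegret_dLinear_lt_of_pos (hk : √(Real.pi / 2) * E.σ₁ < E.k) {ρ : ℝ}
    (hρ : E.IsRhoStar ρ) {γ : ℝ} (hγ : 0 < γ) :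
    E.profiledRegret (wStar n) (dLinear n ρ) γ < E.profiledRegret (wStar n) E.dRT γ := by
  have hσ := E.σ₁_pos
  have hπ : 0 < √(Real.pi / 2) := by positivity
  have hk0 : 0 < E.k := hρ.1.trans hρ.2.1
  have hr : 0 < ρ / E.σ₁ := div_pos hρ.1 hσ
  rw [E.profiledRegret_dLinear hρ.1, E.profiledRegret_dRT hk]
  have h1 := averageCDF_lt hr (by positivity) hρ.normalBandProb_eq_stdNormalPDF (div_pos hγ hσ)
  rw [show γ / E.σ₁ / (E.k / (√(Real.pi / 2) * E.σ₁)) = γ / (E.k / √(Real.pi / 2)) by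
    field_simp] at h1
  -- The tangent bound becomes `averageCDF ≥ (k - γ)/(2k)`, which says exactly that the first branch
  -- of the maximum dominates. For the RT rule its first branch suffices as a lower bound.
  have h2 := le_averageCDF hr (div_pos hγ hσ).le
  rw [hρ.normalBandProb_eq, show 1 / 2 - γ / E.σ₁ * (E.σ₁ / (2 * E.k)) =
    (E.k - γ) / (2 * E.k) by field_simp, div_le_iff₀ (by positivity)] at h2
  rw [max_eq_left (by linarith)]
  exact lt_max_of_lt_left (mul_lt_mul_of_pos_left h1 (by positivity))

theorem profiledRegret_dLinear_lt (hk : √(Real.pi / 2) * E.σ₁ < E.k) {ρ : ℝ}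
    (hρ : E.IsRhoStar ρ) {γ : ℝ} (hγ : γ ≠ 0) :
    E.profiledRegret (wStar n) (dLinear n ρ) γ < E.profiledRegret (wStar n) E.dRT γ := by
  rcases hγ.lt_or_gt with h | h
  · rw [← E.profiledRegret_dLinear_neg hρ.1, ← E.profiledRegret_dRT_neg hk]
    exact E.profiledRegret_dLinear_lt_of_pos hk hρ (neg_pos.2 h)
  · exact E.profiledRegret_dLinear_lt_of_pos hk hρ h

theorem profiledRegret_dLinear_zero (hk : √(Real.pi / 2) * E.σ₁ < E.k) {ρ : ℝ} (hρ : 0 < ρ) :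
    E.profiledRegret (wStar n) (dLinear n ρ) 0 = E.profiledRegret (wStar n) E.dRT 0 := by
  rw [E.profiledRegret_dLinear hρ, E.profiledRegret_dRT hk, zero_div, zero_div, neg_zero,
    averageCDF_zero (div_pos hρ E.σ₁_pos).ne', stdNormalCDF_zero]

end EvidenceAggregation

end

theorem proposition2 {d n : ℕ} [NeZero n] (E : EvidenceAggregation d n)
    (hk : Real.sqrt (Real.pi / 2) * E.σ₁ < E.k) :
    -- the cutoff of the piecewise linear rule is well defined
    (∃! ρ : ℝ, E.IsRhoStar ρ) ∧
    ∀ ρ : ℝ, E.IsRhoStar ρ →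
      -- (i)
      (stdNormalPDF (ρ / E.σ₁) * (E.k / (Real.sqrt (Real.pi / 2) * E.σ₁)) ^ 3 ≤ stdNormalPDF 0 →
        (∀ γ : ℝ,
          E.profiledRegret (EvidenceAggregation.wStar n) (EvidenceAggregation.dLinear n ρ) γ ≤
            E.profiledRegret (EvidenceAggregation.wStar n) E.dRT γ) ∧
        (∀ γ : ℝ, γ ≠ 0 →
          E.profiledRegret (EvidenceAggregation.wStar n) (EvidenceAggregation.dLinear n ρ) γ <
            E.profiledRegret (EvidenceAggregation.wStar n) E.dRT γ)) ∧
      -- (ii)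
      (stdNormalPDF 0 < stdNormalPDF (ρ / E.σ₁) * (E.k / (Real.sqrt (Real.pi / 2) * E.σ₁)) ^ 3 →
        (∃! γ₀ : ℝ, E.IsThreshold ρ γ₀) ∧
        ∀ γ₀ : ℝ, E.IsThreshold ρ γ₀ → ∀ γ : ℝ, γ₀ < |γ| →
          E.profiledRegret (EvidenceAggregation.wStar n) (EvidenceAggregation.dLinear n ρ) γ <
            E.profiledRegret (EvidenceAggregation.wStar n) E.dRT γ) := by
  refine ⟨E.existsUnique_isRhoStar hk, fun ρ hρ => ⟨fun _ => ⟨fun γ => ?_, fun γ hγ => ?_⟩,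
    fun h => absurd h hρ.stdNormalPDF_mul_pow_three_le.not_gt⟩⟩
  · rcases eq_or_ne γ 0 with rfl | hγ
    · exact (E.profiledRegret_dLinear_zero hk hρ.1).le
    · exact (E.profiledRegret_dLinear_lt hk hρ hγ).le
  · exact E.profiledRegret_dLinear_lt hk hρ hγ
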